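/- Let $(\mathcal V,\otimes,I)$ be a cocomplete closed monoidal category, where closed means that for every object $X$ of $\mathcal V$ both functors $X\otimes -$ and $-\otimes X$ have right adjoints (for example, any cocomplete symmetric monoidal closed category). Let $\mathcal V\text{-}\mathbf{Cat}$ be the category of small $\mathcal V$-categories and $\mathcal V$-functors. Call a $\mathcal V$-functor $F:\mathcal X\to\mathcal Y$ a full and faithful inclusion if it is injective on objects and all the morphisms $\mathcal X(x,y)\to\mathcal Y(Fx,Fy)$ are isomorphisms in $\mathcal V$. Let $\mathcal A$, $\mathcal B$, $\mathcal C$ be small $\mathcal V$-categories, let $i:\mathcal A\hookrightarrow\mathcal B$ be a full and faithful inclusion and let $f:\mathcal A\to\mathcal C$ be any $\mathcal V$-functor. Then the pushout of $i$ and $f$ exists in $\mathcal V\text{-}\mathbf{Cat}$, and in every pushout square in $\mathcal V\text{-}\mathbf{Cat}$ $$\begin{array}{ccc}\mathcal A&\xrightarrow{\;i\;}&\mathcal B\\ {\scriptstyle f}\downarrow&&\downarrow{\scriptstyle g}\\ \mathcal C&\xrightarrow{\;i'\;}&\mathcal D\end{array}$$ the $\mathcal V$-functor $i':\mathcal C\to\mathcal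 D$ is a full and faithful inclusion. -/

import Mathlib

universe w v

namespace CategoryTheory

open MonoidalCategory Limits

namespace EnrichedFunctor

universe u₁ u₂

variable {V : Type v} [Category.{w} V] [MonoidalCategory V]
variable {A : Type u₁} [EnrichedCategory V A] {B : Type u₂} [EnrichedCategory V B]

/-- A `V`-functor is full and faithful if it is locally an isomorphism, that is, if all its
action morphisms `A(x, y) ⟶ B(F x, F y)` are isomorphisms in `V`. -/
def FullAndFaithful (F : EnrichedFunctor V A B) : Prop :=
  ∀ x y : A, IsIso (F.map x y)

/-- A full and faithful inclusion of `V`-categories: a full and faithful `V`-functor that is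
injective on objects. -/
structure IsFullAndFaithfulInclusion (F : EnrichedFunctor V A B) : Prop where
  fullAndFaithful : F.FullAndFaithful
  injective_obj : Function.Injective F.obj

end EnrichedFunctor

/-- The 1-category `V-Cat`: objects are `V`-categories, morphisms are `V`-functors with their
usual identities and composition, and two `V`-functors are identified only if they are equal
(not merely isomorphic). -/
instance EnrichedCat.category (V : Type v) [Category.{w} V] [MonoidalCategory V] :
    Category (EnrichedCat.{w, v, w} V) where
  Hom A B := EnrichedFunctor V A B
  id A := EnrichedFunctor.id V A
  comp F G := EnrichedFunctor.comp V F G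
  id_comp F := by
    cases F
    simp [EnrichedFunctor.comp, EnrichedFunctor.id]
  comp_id F := by
    cases F
    simp [EnrichedFunctor.comp, EnrichedFunctor.id]
  assoc F G H := by
    simp [EnrichedFunctor.comp]

end CategoryTheory

open CategoryTheory MonoidalCategory Limits

open CategoryTheory MonoidalCategory Limits

noncomputable section

/-! Split the objects of `B` into those of `A` and a complement `B'`. The pushout should have
objects `C ⊕ B'`, and a module over it should be a `GluedModule`: a family on `C ⊕ B'` with actions
of `C` and of `B` that agree on `A`. The pushout is reconstructed from these modules. If evaluation
at each `x` is represented by a glued module `Q x` with a universal element, then `Q x y` serves as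
the hom object from `x` to `y`, the universal elements are the identities, and composition comes
from Yoneda. Cotensors upgrade the representing property to maps out of `K ⊗ Q x` (`exists_isKHom`,
`isKHom_ext`), which is what composition and associativity need. A cocone with vertex `X` makes the
representables of `X` into glued modules, and this gives the universal property.

Full faithfulness of `i` enters through representability. At `c` one takes `C(c, -)` over `C` and,
over `B`, the left Kan extension along `i` of its restriction to `A`. At `b` one first extends the
restriction of `B(b, -)` along `f` to a `C`-module, then enlarges `B(b, -)` by a pushout of
`B`-modules so that it acquires this new restriction to `A`. In both cases `ModuleSpan.isIso_unit`
shows that extending along `i` does not alter the values on `A`, so the two parts glue. By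
construction the hom object between `c` and `c'` is `C(c, c')` itself, so the functor from `C` is
locally an identity. -/

namespace EnrichedPushout

universe u₁ u₂

/-! ### Modules over a `V`-category: restriction, Yoneda, cotensors -/

section

variable {V : Type v} [Category.{w} V] [MonoidalCategory V]

/-- A right module structure over the `V`-category `B` on a family of objects of `V`. -/
structure Action (B : Type u₁) [EnrichedCategory V B] (M : B → V) where
  act : ∀ x y, M x ⊗ (x ⟶[V] y) ⟶ M y
  act_id : ∀ x, M x ◁ eId V x ≫ act x x = (ρ_ (M x)).hom
  act_comp : ∀ x y z, act x y ▷ (y ⟶[V] z) ≫ act y z =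
    (α_ (M x) (x ⟶[V] y) (y ⟶[V] z)).hom ≫ M x ◁ eComp V x y z ≫ act x z

namespace Action

variable {A : Type u₂} [EnrichedCategory V A] {B : Type u₁} [EnrichedCategory V B]

attribute [simp] act_id

/-- Restriction of a module along a `V`-functor. -/
@[simps]
def restrict {M : B → V} (β : Action B M) (F : EnrichedFunctor V A B) :
    Action A (fun a => M (F.obj a)) where
  act x y := M (F.obj x) ◁ F.map x y ≫ β.act (F.obj x) (F.obj y)
  act_id x := by
    rw [← whiskerLeft_comp_assoc, F.map_id, β.act_id]
  act_comp x y z := by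
    rw [comp_whiskerRight, Category.assoc, ← whisker_exchange_assoc, β.act_comp,
      ← whiskerLeft_comp_assoc, F.map_comp]
    simp [MonoidalCategory.tensorHom_def]

/-- The module represented by an object. -/
@[simps]
def representable (b : B) : Action B (fun y => (b ⟶[V] y)) where
  act x y := eComp V b x y
  act_id x := by
    rw [← cancel_epi (ρ_ _).inv, e_comp_id, Iso.inv_hom_id]
  act_comp x y z := by
    rw [e_assoc']

/-- Transport of a module structure along a family of isomorphisms. -/
@[simps]
def transport {M N : B → V} (β : Action B M) (e : ∀ x, M x ≅ N x) : Action B N where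
  act x y := (e x).inv ▷ _ ≫ β.act x y ≫ (e y).hom
  act_id x := by
    rw [whisker_exchange_assoc, reassoc_of% β.act_id]
    simp
  act_comp x y z := by
    simp only [comp_whiskerRight, Category.assoc, hom_inv_whiskerRight_assoc]
    rw [reassoc_of% β.act_comp, associator_naturality_left_assoc, whisker_exchange_assoc]

/-- Module homomorphisms. -/
def Linear {M N : B → V} (α : Action B M) (β : Action B N) (φ : ∀ x, M x ⟶ N x) : Prop :=
  ∀ x y, φ x ▷ (x ⟶[V] y) ≫ β.act x y = α.act x y ≫ φ y

/-- Module homomorphisms out of the family `K ⊗ M`. -/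
def KLinear (K : V) {M N : B → V} (α : Action B M) (β : Action B N)
    (φ : ∀ x, K ⊗ M x ⟶ N x) : Prop :=
  ∀ x y, φ x ▷ (x ⟶[V] y) ≫ β.act x y = (α_ K (M x) _).hom ≫ K ◁ α.act x y ≫ φ y

variable {M N P : B → V} {α : Action B M} {β : Action B N} {γ : Action B P}

lemma Linear.comp {φ : ∀ x, M x ⟶ N x} {ψ : ∀ x, N x ⟶ P x}
    (hφ : Linear α β φ) (hψ : Linear β γ ψ) : Linear α γ (fun x => φ x ≫ ψ x) := by
  intro x y
  rw [comp_whiskerRight, Category.assoc, hψ, ← Category.assoc, hφ, Category.assoc]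

lemma Linear.restrict {φ : ∀ x, M x ⟶ N x} (hφ : Linear α β φ) (F : EnrichedFunctor V A B) :
    Linear (α.restrict F) (β.restrict F) (fun a => φ (F.obj a)) := by
  intro x y
  simp only [restrict_act, Category.assoc]
  rw [← hφ, whisker_exchange_assoc]

lemma linear_transport (e : ∀ x, M x ≅ N x) : Linear α (α.transport e) (fun x => (e x).hom) := by
  intro x y
  simp

lemma Linear.inv {e : ∀ x, M x ≅ N x} (h : Linear α β (fun x => (e x).hom)) :
    Linear β α (fun x => (e x).inv) := by
  intro x y
  rw [← cancel_mono (e y).hom, Category.assoc, ← h x y]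
  simp

/-- The homomorphism out of a representable module named by an element. -/
def yonedaHom (β : Action B N) {b : B} (e : 𝟙_ V ⟶ N b) (y : B) : (b ⟶[V] y) ⟶ N y :=
  (λ_ _).inv ≫ e ▷ _ ≫ β.act b y

lemma yonedaHom_linear (β : Action B N) {b : B} (e : 𝟙_ V ⟶ N b) :
    Linear (representable b) β (β.yonedaHom e) := by
  intro x y
  simp only [yonedaHom, comp_whiskerRight, Category.assoc, representable_act]
  rw [β.act_comp, associator_naturality_left_assoc, ← whisker_exchange_assoc]
  simp

lemma eId_yonedaHom (β : Action B N) {b : B} (e : 𝟙_ V ⟶ N b) :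
    eId V b ≫ β.yonedaHom e b = e := by
  simp only [yonedaHom]
  rw [leftUnitor_inv_naturality_assoc, whisker_exchange_assoc, β.act_id, rightUnitor_naturality]
  simp [unitors_inv_equal]

/-- Uniqueness in the Yoneda lemma: linearity moves `φ` past the action, and composing with the
identity of `b` does nothing. -/
lemma Linear.eq_yonedaHom {b : B} {φ : ∀ y, (b ⟶[V] y) ⟶ N y}
    (h : Linear (representable b) β φ) (y : B) : φ y = β.yonedaHom (eId V b ≫ φ b) y := by
  simp only [yonedaHom, comp_whiskerRight, Category.assoc]
  rw [h b y]
  simp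

lemma Linear.yonedaHom_comp {b : B} {φ : ∀ x, N x ⟶ P x} (h : Linear β γ φ)
    (e : 𝟙_ V ⟶ N b) (y : B) :
    β.yonedaHom e y ≫ φ y = γ.yonedaHom (e ≫ φ b) y := by
  simp only [yonedaHom, comp_whiskerRight, Category.assoc]
  rw [h b y]

lemma KLinear.comp_linear {K : V} {φ : ∀ x, K ⊗ M x ⟶ N x} {ψ : ∀ x, N x ⟶ P x}
    (hφ : KLinear K α β φ) (hψ : Linear β γ ψ) : KLinear K α γ (fun x => φ x ≫ ψ x) := by
  intro x y
  rw [comp_whiskerRight, Category.assoc, hψ, ← Category.assoc, hφ]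
  simp only [Category.assoc]

lemma KLinear.linear_comp {K : V} {φ : ∀ x, M x ⟶ N x} {ψ : ∀ x, K ⊗ N x ⟶ P x}
    (hφ : Linear α β φ) (hψ : KLinear K β γ ψ) : KLinear K α γ (fun x => K ◁ φ x ≫ ψ x) := by
  intro x y
  rw [comp_whiskerRight, Category.assoc, hψ, associator_naturality_middle_assoc,
    ← whiskerLeft_comp_assoc, hφ, whiskerLeft_comp_assoc]

lemma KLinear.whiskerRight_comp {K L : V} (k : L ⟶ K) {φ : ∀ x, K ⊗ M x ⟶ N x}
    (hφ : KLinear K α β φ) : KLinear L α β (fun x => k ▷ M x ≫ φ x) := by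
  intro x y
  rw [comp_whiskerRight, Category.assoc, hφ, associator_naturality_left_assoc,
    ← whisker_exchange_assoc]

lemma KLinear.comp {K L : V} {φ : ∀ x, L ⊗ M x ⟶ N x} {ψ : ∀ x, K ⊗ N x ⟶ P x}
    (hφ : KLinear L α β φ) (hψ : KLinear K β γ ψ) :
    KLinear (K ⊗ L) α γ (fun x => (α_ K L (M x)).hom ≫ K ◁ φ x ≫ ψ x) := by
  intro x y
  simp only [comp_whiskerRight, Category.assoc]
  rw [hψ, associator_naturality_middle_assoc, ← whiskerLeft_comp_assoc, hφ]
  simp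

lemma KLinear.unitor_comp {K : V} {φ : ∀ x, K ⊗ M x ⟶ N x} (hφ : KLinear K α β φ)
    (k : 𝟙_ V ⟶ K) : Linear α β (fun x => (λ_ (M x)).inv ≫ k ▷ M x ≫ φ x) := by
  intro x y
  have h := hφ.whiskerRight_comp k x y
  rw [comp_whiskerRight, Category.assoc, h, leftUnitor_inv_naturality_assoc]
  simp

section Closed

variable [MonoidalClosed V]

/-- Evaluation at the internal hom. -/
def eval (K X : V) : K ⊗ (CategoryTheory.ihom K).obj X ⟶ X := MonoidalClosed.uncurry (𝟙 _)

@[simp]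
lemma whiskerLeft_curry_eval {K X Y : V} (f : K ⊗ Y ⟶ X) :
    K ◁ MonoidalClosed.curry f ≫ eval K X = f := by
  rw [eval, ← MonoidalClosed.uncurry_natural_left, Category.comp_id, MonoidalClosed.uncurry_curry]

lemma hom_ihom_ext {K X Y : V} {f g : Y ⟶ (CategoryTheory.ihom K).obj X}
    (h : K ◁ f ≫ eval K X = K ◁ g ≫ eval K X) : f = g := by
  apply MonoidalClosed.uncurry_injective
  simpa only [eval, ← MonoidalClosed.uncurry_natural_left, Category.comp_id] using h

/-- The cotensor of a module with an object of `V`. -/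
@[simps]
def ihom (K : V) (β : Action B N) : Action B (fun x => (CategoryTheory.ihom K).obj (N x)) where
  act x y := MonoidalClosed.curry ((α_ K _ _).inv ≫ eval K (N x) ▷ _ ≫ β.act x y)
  act_id x := by
    apply hom_ihom_ext
    rw [whiskerLeft_comp_assoc, whiskerLeft_curry_eval,
      associator_inv_naturality_right_assoc, whisker_exchange_assoc, β.act_id,
      rightUnitor_naturality]
    simp
  act_comp x y z := by
    apply hom_ihom_ext
    simp only [whiskerLeft_comp_assoc, whiskerLeft_curry_eval]
    rw [associator_inv_naturality_middle_assoc, ← comp_whiskerRight_assoc,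
      whiskerLeft_curry_eval]
    simp only [comp_whiskerRight, Category.assoc, β.act_comp]
    rw [associator_inv_naturality_right_assoc, whisker_exchange_assoc,
      associator_naturality_left_assoc]
    simp

/-- Cotensors are pointwise, so they commute with restriction; this makes the cotensor of a glued
module glued again. -/
lemma restrict_ihom_act (K : V) (β : Action B N) (F : EnrichedFunctor V A B) (x y : A) :
    ((β.ihom K).restrict F).act x y = ((β.restrict F).ihom K).act x y := by
  apply hom_ihom_ext
  simp only [restrict_act, ihom_act, whiskerLeft_comp_assoc, whiskerLeft_curry_eval]
  rw [associator_inv_naturality_right_assoc, whisker_exchange_assoc]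

/-- This reduces every question about maps with a parameter `K` to plain homomorphisms into a
cotensor. -/
lemma linear_curry_iff {K : V} {φ : ∀ x, K ⊗ M x ⟶ N x} :
    Linear α (β.ihom K) (fun x => MonoidalClosed.curry (φ x)) ↔ KLinear K α β φ := by
  refine forall₂_congr fun x y => ?_
  have h : MonoidalClosed.curry (φ x) ▷ _ ≫ (β.ihom K).act x y =
      MonoidalClosed.curry ((α_ K (M x) _).inv ≫ φ x ▷ _ ≫ β.act x y) := by
    apply hom_ihom_ext
    rw [whiskerLeft_comp_assoc, ihom_act, whiskerLeft_curry_eval, whiskerLeft_curry_eval,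
      associator_inv_naturality_middle_assoc, ← comp_whiskerRight_assoc, whiskerLeft_curry_eval]
  rw [h, ← MonoidalClosed.curry_natural_left, MonoidalClosed.curry_injective.eq_iff,
    Iso.inv_comp_eq]

lemma Linear.uncurry {K : V} {φ : ∀ x, M x ⟶ (CategoryTheory.ihom K).obj (N x)}
    (h : Linear α (β.ihom K) φ) : KLinear K α β (fun x => MonoidalClosed.uncurry (φ x)) := by
  rw [← linear_curry_iff]
  simpa using h

end Closed

end Action

end

/-! ### Pushouts of modules along left Kan extensions -/

section

variable {V : Type v} [Category.{w} V] [MonoidalCategory V]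

section RightAdjoint

variable [∀ X : V, (tensorRight X).IsLeftAdjoint]

/-- Currying on the right. -/
def rightCurry (Y L X : V) : (Y ⊗ L ⟶ X) ≃ (Y ⟶ (tensorRight L).rightAdjoint.obj X) :=
  (Adjunction.ofIsLeftAdjoint (tensorRight L)).homEquiv Y X

lemma rightCurry_naturality {Y Y' L X : V} (f : Y ⟶ Y') (g : Y' ⊗ L ⟶ X) :
    rightCurry Y L X (f ▷ L ≫ g) = f ≫ rightCurry Y' L X g :=
  Adjunction.homEquiv_naturality_left _ _ _

end RightAdjoint

variable {A : Type w} [EnrichedCategory V A] {B : Type u₁} [EnrichedCategory V B]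

/-- A `B`-module together with a homomorphism from its restriction along `F` to an `A`-module. -/
structure ModuleSpan (F : EnrichedFunctor V A B) where
  N : B → V
  ν : Action B N
  P : A → V
  π : Action A P
  θ : ∀ a, N (F.obj a) ⟶ P a
  linear : (ν.restrict F).Linear π θ

namespace ModuleSpan

variable {F : EnrichedFunctor V A B} (S : ModuleSpan F)

/-- The shape of the colimits computing `ModuleSpan.ext`. -/
@[simps]
def shape (A : Type w) : MultispanShape.{w, w} where
  L := (A × A) ⊕ A
  R := Option A
  fst := Sum.elim (fun x => some x.2) (fun _ => none)
  snd := Sum.elim (fun x => some x.1) (fun a => some a)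

/-- The diagram whose colimit is the extension at `y`. -/
@[simps]
def index (y : B) : MultispanIndex (shape A) V where
  left := Sum.elim (fun x => (S.P x.1 ⊗ (x.1 ⟶[V] x.2)) ⊗ (F.obj x.2 ⟶[V] y))
    (fun a => S.N (F.obj a) ⊗ (F.obj a ⟶[V] y))
  right := fun o => o.elim (S.N y) (fun a => S.P a ⊗ (F.obj a ⟶[V] y))
  fst := fun x => match x with
    | Sum.inl (a, a') => S.π.act a a' ▷ (F.obj a' ⟶[V] y)
    | Sum.inr a => S.ν.act (F.obj a) y
  snd := fun x => match x with
    | Sum.inl (a, a') => (α_ _ _ _).hom ≫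
        S.P a ◁ (F.map a a' ▷ (F.obj a' ⟶[V] y) ≫ eComp V (F.obj a) (F.obj a') y)
    | Sum.inr a => S.θ a ▷ (F.obj a ⟶[V] y)

variable [HasColimitsOfSize.{w, w} V]

/-- The underlying family of the pushout of the `B`-module `S.N` along the map induced by `S.θ`
between left Kan extensions along `F`. -/
def ext (y : B) : V := multicoequalizer (S.index y)

/-- The inclusion of `S.N`. -/
def inclN (y : B) : S.N y ⟶ S.ext y := Multicoequalizer.π (S.index y) none

/-- The inclusion of the summands of the Kan extension of `S.P`. -/
def inclP (a : A) (y : B) : S.P a ⊗ (F.obj a ⟶[V] y) ⟶ S.ext y :=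
  Multicoequalizer.π (S.index y) (some a)

/-- The tensor relation over `A`: an arrow of `A` may act on `P` or be absorbed into the arrow of
`B`. -/
lemma act_inclP (a a' : A) (y : B) :
    S.π.act a a' ▷ (F.obj a' ⟶[V] y) ≫ S.inclP a' y = (α_ _ _ _).hom ≫
        S.P a ◁ (F.map a a' ▷ (F.obj a' ⟶[V] y) ≫ eComp V (F.obj a) (F.obj a') y) ≫
          S.inclP a y := by
  have := Multicoequalizer.condition (S.index y) (Sum.inl (a, a'))
  exact this.trans (Category.assoc _ _ _)

lemma act_inclN (a : A) (y : B) :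
    S.ν.act (F.obj a) y ≫ S.inclN y = S.θ a ▷ (F.obj a ⟶[V] y) ≫ S.inclP a y :=
  Multicoequalizer.condition (S.index y) (Sum.inr a)

variable {S} in
lemma hom_ext {y : B} {X : V} {f g : S.ext y ⟶ X} (hN : S.inclN y ≫ f = S.inclN y ≫ g)
    (hP : ∀ a, S.inclP a y ≫ f = S.inclP a y ≫ g) : f = g := by
  refine Multicoequalizer.hom_ext (S.index y) f g ?_
  rintro (_ | a)
  · exact hN
  · exact hP a

lemma exists_desc {y : B} {X : V} (k : S.N y ⟶ X) (l : ∀ a, S.P a ⊗ (F.obj a ⟶[V] y) ⟶ X)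
    (h₁ : ∀ a a', S.π.act a a' ▷ (F.obj a' ⟶[V] y) ≫ l a' = (α_ _ _ _).hom ≫
        S.P a ◁ (F.map a a' ▷ (F.obj a' ⟶[V] y) ≫ eComp V (F.obj a) (F.obj a') y) ≫ l a)
    (h₂ : ∀ a, S.ν.act (F.obj a) y ≫ k = S.θ a ▷ (F.obj a ⟶[V] y) ≫ l a) :
    ∃ d : S.ext y ⟶ X, S.inclN y ≫ d = k ∧ ∀ a, S.inclP a y ≫ d = l a := by
  refine ⟨Multicoequalizer.desc (S.index y) X
    (fun o => match o with | none => k | some a => l a) ?_, ?_, ?_⟩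
  · rintro (⟨a, a'⟩ | a)
    · exact (h₁ a a').trans (Category.assoc _ _ _).symm
    · exact h₂ a
  · exact Multicoequalizer.π_desc (S.index y) _ _ _ none
  · exact fun a => Multicoequalizer.π_desc (S.index y) _ _ _ (some a)

/-- The inclusion of `S.P`. -/
def unit (a : A) : S.P a ⟶ S.ext (F.obj a) :=
  (ρ_ _).inv ≫ S.P a ◁ eId V (F.obj a) ≫ S.inclP a (F.obj a)

lemma θ_unit (a : A) : S.θ a ≫ S.unit a = S.inclN (F.obj a) := by
  rw [unit, rightUnitor_inv_naturality_assoc, ← whisker_exchange_assoc, ← act_inclN,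
    reassoc_of% S.ν.act_id, Iso.inv_hom_id_assoc]

variable [∀ X : V, (tensorRight X).IsLeftAdjoint]

-- Since `- ⊗ L` is a left adjoint, it preserves the colimit `ext y`; currying on the right replaces
-- an explicit comparison of colimits.
variable {S} in
lemma tensor_hom_ext {y : B} {L X : V} {f g : S.ext y ⊗ L ⟶ X}
    (hN : S.inclN y ▷ L ≫ f = S.inclN y ▷ L ≫ g)
    (hP : ∀ a, S.inclP a y ▷ L ≫ f = S.inclP a y ▷ L ≫ g) : f = g := by
  apply (rightCurry _ _ _).injective
  apply hom_ext
  · rw [← rightCurry_naturality, hN, rightCurry_naturality]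
  · intro a
    rw [← rightCurry_naturality, hP, rightCurry_naturality]

lemma exists_tensor_desc {y : B} {L X : V} (k : S.N y ⊗ L ⟶ X)
    (l : ∀ a, (S.P a ⊗ (F.obj a ⟶[V] y)) ⊗ L ⟶ X)
    (h₁ : ∀ a a', (S.π.act a a' ▷ (F.obj a' ⟶[V] y)) ▷ L ≫ l a' = ((α_ _ _ _).hom ≫
        S.P a ◁ (F.map a a' ▷ (F.obj a' ⟶[V] y) ≫
          eComp V (F.obj a) (F.obj a') y)) ▷ L ≫ l a)
    (h₂ : ∀ a, S.ν.act (F.obj a) y ▷ L ≫ k = (S.θ a ▷ (F.obj a ⟶[V] y)) ▷ L ≫ l a) :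
    ∃ d : S.ext y ⊗ L ⟶ X, S.inclN y ▷ L ≫ d = k ∧ ∀ a, S.inclP a y ▷ L ≫ d = l a := by
  obtain ⟨d, hd₁, hd₂⟩ := S.exists_desc (y := y) (rightCurry _ L X k)
    (fun a => rightCurry _ L X (l a))
    (fun a a' => by
      rw [← rightCurry_naturality, h₁, rightCurry_naturality, Category.assoc])
    (fun a => by rw [← rightCurry_naturality, h₂, rightCurry_naturality])
  obtain ⟨d, rfl⟩ := (rightCurry _ L X).surjective d
  refine ⟨d, ?_, fun a => ?_⟩
  · rwa [← rightCurry_naturality, (rightCurry _ L X).injective.eq_iff] at hd₁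
  · have := hd₂ a
    rwa [← rightCurry_naturality, (rightCurry _ L X).injective.eq_iff] at this

/-- `B` acts on the summand `N y` by `ν`, and on `P a ⊗ B(F a, y)` by composition in the second
factor. Associativity in `B` makes this respect the relations. -/
lemma exists_act (y z : B) : ∃ d : S.ext y ⊗ (y ⟶[V] z) ⟶ S.ext z,
    S.inclN y ▷ _ ≫ d = S.ν.act y z ≫ S.inclN z ∧
    ∀ a, S.inclP a y ▷ _ ≫ d = (α_ _ _ _).hom ≫ S.P a ◁ eComp V (F.obj a) y z ≫
      S.inclP a z := by
  refine S.exists_tensor_desc _ _ (fun a a' => ?_) (fun a => ?_)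
  · have key : ((F.map a a' ▷ (F.obj a' ⟶[V] y) ≫ eComp V (F.obj a) (F.obj a') y) ▷ (y ⟶[V] z)) ≫
        eComp V (F.obj a) y z = (α_ _ _ _).hom ≫ (a ⟶[V] a') ◁ eComp V (F.obj a') y z ≫
          F.map a a' ▷ _ ≫ eComp V (F.obj a) (F.obj a') z := by
      rw [comp_whiskerRight, Category.assoc, ← e_assoc', associator_naturality_left_assoc,
        ← whisker_exchange_assoc]
    rw [associator_naturality_left_assoc, ← whisker_exchange_assoc, act_inclP,
      comp_whiskerRight, Category.assoc, associator_naturality_middle_assoc,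
      ← whiskerLeft_comp_assoc, key]
    simp
  · rw [reassoc_of% S.ν.act_comp, act_inclN, associator_naturality_left_assoc, whisker_exchange_assoc]

/-- The action on the extension. -/
def extAct (y z : B) : S.ext y ⊗ (y ⟶[V] z) ⟶ S.ext z := (S.exists_act y z).choose

lemma inclN_extAct (y z : B) :
    S.inclN y ▷ _ ≫ S.extAct y z = S.ν.act y z ≫ S.inclN z :=
  (S.exists_act y z).choose_spec.1

lemma inclP_extAct (a : A) (y z : B) :
    S.inclP a y ▷ _ ≫ S.extAct y z = (α_ _ _ _).hom ≫ S.P a ◁ eComp V (F.obj a) y z ≫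
      S.inclP a z :=
  (S.exists_act y z).choose_spec.2 a

/-- The module structure on the extension. -/
@[simps]
def extAction : Action B S.ext where
  act := S.extAct
  act_id y := by
    apply tensor_hom_ext
    · rw [← whisker_exchange_assoc, inclN_extAct, reassoc_of% S.ν.act_id, rightUnitor_naturality]
    · intro a
      rw [← whisker_exchange_assoc, inclP_extAct, rightUnitor_naturality]
      have := (Action.representable (V := V) (F.obj a)).act_id y
      simp only [Action.representable_act] at this
      rw [associator_naturality_right_assoc, ← whiskerLeft_comp_assoc, this]
      simp
  act_comp x y z := by
    rw [← cancel_epi (α_ _ _ _).inv, Iso.inv_hom_id_assoc]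
    apply tensor_hom_ext
    · rw [associator_inv_naturality_left_assoc, ← comp_whiskerRight_assoc, inclN_extAct,
        comp_whiskerRight_assoc, inclN_extAct, reassoc_of% S.ν.act_comp, Iso.inv_hom_id_assoc,
        ← whisker_exchange_assoc, inclN_extAct]
    · intro a
      rw [associator_inv_naturality_left_assoc, ← comp_whiskerRight_assoc, inclP_extAct,
        ← whisker_exchange_assoc, inclP_extAct, associator_naturality_right_assoc]
      simp only [comp_whiskerRight, Category.assoc, inclP_extAct]
      have h := congrArg (fun t => S.P a ◁ t ≫ S.inclP a z) (e_assoc V (F.obj a) x y z)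
      simp only [whiskerLeft_comp, Category.assoc] at h
      simp [h]

lemma inclN_linear : S.ν.Linear S.extAction S.inclN := fun _ _ => S.inclN_extAct _ _

/-- Hence the module `ext` is generated by the images of `N` and of `unit`, which is why
`linear_ext` tests only on these. -/
lemma unit_extAct (a : A) (y : B) : S.unit a ▷ _ ≫ S.extAct (F.obj a) y = S.inclP a y := by
  simp only [unit, comp_whiskerRight, Category.assoc, inclP_extAct]
  rw [associator_naturality_middle_assoc, ← whiskerLeft_comp_assoc]
  have := e_id_comp V (F.obj a) y
  rw [Iso.inv_comp_eq, Category.comp_id] at this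
  rw [this]
  simp

lemma unit_linear : S.π.Linear (S.extAction.restrict F) S.unit := by
  intro a a'
  simp only [Action.restrict_act, extAction_act]
  rw [← whisker_exchange_assoc, unit_extAct, unit, rightUnitor_inv_naturality_assoc,
    ← whisker_exchange_assoc, act_inclP, associator_naturality_right_assoc,
    ← whiskerLeft_comp_assoc, whisker_exchange_assoc]
  have := e_comp_id V (F.obj a) (F.obj a')
  rw [Iso.inv_comp_eq, Category.comp_id] at this
  rw [this]
  simp

variable {S} in
/-- Homomorphisms out of the extension are determined by their restrictions. -/
lemma linear_ext {R : B → V} {ρ : Action B R} {φ ψ : ∀ y, S.ext y ⟶ R y}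
    (hφ : S.extAction.Linear ρ φ) (hψ : S.extAction.Linear ρ ψ)
    (hN : ∀ y, S.inclN y ≫ φ y = S.inclN y ≫ ψ y)
    (hP : ∀ a, S.unit a ≫ φ (F.obj a) = S.unit a ≫ ψ (F.obj a)) (y : B) : φ y = ψ y := by
  refine hom_ext (hN y) (fun a => ?_)
  rw [← unit_extAct, Category.assoc, Category.assoc]
  erw [← hφ, ← hψ]
  rw [← comp_whiskerRight_assoc, hP, comp_whiskerRight_assoc]

/-- On `P a ⊗ B(F a, y)` the map has to be `ψ` followed by the action; linearity of `ψ` over `A`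
gives the tensor relation and `h` the relation with `N`. -/
lemma exists_linear_desc {R : B → V} (ρ : Action B R) {φ : ∀ y, S.N y ⟶ R y}
    (hφ : S.ν.Linear ρ φ) {ψ : ∀ a, S.P a ⟶ R (F.obj a)}
    (hψ : S.π.Linear (ρ.restrict F) ψ) (h : ∀ a, S.θ a ≫ ψ a = φ (F.obj a)) :
    ∃ χ : ∀ y, S.ext y ⟶ R y, S.extAction.Linear ρ χ ∧ (∀ y, S.inclN y ≫ χ y = φ y) ∧
      ∀ a, S.unit a ≫ χ (F.obj a) = ψ a := by
  have H (y : B) := S.exists_desc (φ y) (fun a => ψ a ▷ (F.obj a ⟶[V] y) ≫ ρ.act (F.obj a) y)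
    (fun a a' => by
      rw [← comp_whiskerRight_assoc, ← hψ]
      simp only [Action.restrict_act, comp_whiskerRight, Category.assoc, ρ.act_comp]
      rw [associator_naturality_middle_assoc, associator_naturality_left_assoc,
        whiskerLeft_comp_assoc, whisker_exchange_assoc, whisker_exchange_assoc])
    (fun a => by rw [← hφ, ← h, comp_whiskerRight_assoc])
  choose χ hχN hχP using H
  refine ⟨χ, fun y z => ?_, hχN, fun a => ?_⟩
  · apply tensor_hom_ext
    · rw [extAction_act, reassoc_of% S.inclN_extAct, hχN, ← hφ, ← comp_whiskerRight_assoc, hχN]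
    · intro a
      rw [extAction_act, reassoc_of% S.inclP_extAct, hχP, ← comp_whiskerRight_assoc, hχP]
      rw [comp_whiskerRight_assoc, ρ.act_comp, associator_naturality_left_assoc,
        whisker_exchange_assoc]
  · rw [unit, Category.assoc, Category.assoc, hχP, whisker_exchange_assoc, ρ.act_id,
      rightUnitor_naturality, Iso.inv_hom_id_assoc]

/-- Extension along a fully faithful `V`-functor does not change the module on its image. -/
lemma isIso_unit (hF : F.FullAndFaithful) (a : A) : IsIso (S.unit a) := by
  have := hF
  unfold EnrichedFunctor.FullAndFaithful at this
  -- The inverse of the unit: on `N` it is `θ`; on the summand of `a'` an arrow `F a' ⟶ F a` is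
  -- pulled back to `A(a', a)`, which then acts on `P`.
  obtain ⟨d, hN, hP⟩ := S.exists_desc (y := F.obj a) (S.θ a)
    (fun a' => S.P a' ◁ inv (F.map a' a) ≫ S.π.act a' a)
    (fun a₁ a₂ => by
      rw [← whisker_exchange_assoc, S.π.act_comp, associator_naturality_right_assoc,
        ← whiskerLeft_comp_assoc, ← whiskerLeft_comp_assoc]
      congr 3
      rw [← cancel_mono (F.map a₁ a)]
      simp [MonoidalCategory.tensorHom_def, ← whisker_exchange_assoc])
    (fun a' => by
      rw [← whisker_exchange_assoc, ← cancel_epi (S.N (F.obj a') ◁ F.map a' a)]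
      rw [← whiskerLeft_comp_assoc, IsIso.hom_inv_id]
      have := S.linear a' a
      simp only [Action.restrict_act, Category.assoc] at this
      simp [this])
  refine ⟨d, ?_, ?_⟩
  · rw [unit, Category.assoc, Category.assoc, hP, ← whiskerLeft_comp_assoc]
    have : eId V (F.obj a) ≫ inv (F.map a a) = eId V a := by
      rw [IsIso.comp_inv_eq, F.map_id]
    rw [this, S.π.act_id, Iso.inv_hom_id]
  · apply hom_ext
    · rw [reassoc_of% hN, θ_unit, Category.comp_id]
    · intro a'
      rw [reassoc_of% (hP a'), ← S.unit_linear a' a, Category.comp_id]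
      simp only [Action.restrict_act, extAction_act]
      rw [← unit_extAct, whisker_exchange_assoc, ← whiskerLeft_comp_assoc, IsIso.inv_hom_id]
      simp

end ModuleSpan

end

/-! ### Left Kan extensions of modules -/

section

variable {V : Type v} [Category.{w} V] [MonoidalCategory V]

section Kan

variable [HasInitial V] [∀ X : V, (tensorRight X).IsLeftAdjoint]

/-- Right tensoring is a left adjoint, so it keeps the initial object initial. -/
lemma initial_tensor_hom_ext {L X : V} (f g : (⊥_ V) ⊗ L ⟶ X) : f = g :=
  (rightCurry _ _ _).injective (initialIsInitial.hom_ext _ _)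

/-- The initial module. -/
def initialAction (B : Type u₁) [EnrichedCategory V B] : Action B (fun _ => ⊥_ V) where
  act x y := (rightCurry _ _ _).symm (initial.to _)
  act_id x := initial_tensor_hom_ext _ _
  act_comp x y z := by
    rw [← cancel_epi (α_ _ _ _).inv]
    exact initial_tensor_hom_ext _ _

/-- The span whose extension is the left Kan extension of the module `π` along `F`. -/
@[simps]
def kanSpan {A : Type w} [EnrichedCategory V A] {B : Type u₁} [EnrichedCategory V B]
    (F : EnrichedFunctor V A B) {P : A → V} (π : Action A P) : ModuleSpan F where
  N _ := ⊥_ V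
  ν := initialAction B
  P := P
  π := π
  θ _ := initial.to _
  linear _ _ := initial_tensor_hom_ext _ _

variable [HasColimitsOfSize.{w, w} V]
  {A : Type w} [EnrichedCategory V A] {B : Type u₁} [EnrichedCategory V B]
  {F : EnrichedFunctor V A B} {P : A → V} {π : Action A P}

lemma kanSpan_linear_ext {R : B → V} {ρ : Action B R} {φ ψ : ∀ y, (kanSpan F π).ext y ⟶ R y}
    (hφ : (kanSpan F π).extAction.Linear ρ φ) (hψ : (kanSpan F π).extAction.Linear ρ ψ)
    (hP : ∀ a, (kanSpan F π).unit a ≫ φ (F.obj a) = (kanSpan F π).unit a ≫ ψ (F.obj a)) (y : B) :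
    φ y = ψ y :=
  ModuleSpan.linear_ext hφ hψ (fun _ => initialIsInitial.hom_ext _ _) hP y

lemma kanSpan_exists_linear_desc {R : B → V} (ρ : Action B R) {ψ : ∀ a, P a ⟶ R (F.obj a)}
    (hψ : π.Linear (ρ.restrict F) ψ) :
    ∃ χ : ∀ y, (kanSpan F π).ext y ⟶ R y, (kanSpan F π).extAction.Linear ρ χ ∧
      ∀ a, (kanSpan F π).unit a ≫ χ (F.obj a) = ψ a := by
  obtain ⟨χ, h, -, h'⟩ := (kanSpan F π).exists_linear_desc ρ (φ := fun _ => initial.to _)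
    (fun _ _ => initial_tensor_hom_ext _ _) hψ (fun _ => initialIsInitial.hom_ext _ _)
  exact ⟨χ, h, h'⟩

end Kan

/-! ### `V`-functors with a fixed object map -/

/-- A `V`-functor with prescribed action on objects. -/
structure FunctorOn (V : Type v) [Category.{w} V] [MonoidalCategory V] {A X : Type*}
    [EnrichedCategory V A] [EnrichedCategory V X] (o : A → X) where
  map : ∀ a b : A, (a ⟶[V] b) ⟶ (o a ⟶[V] o b)
  map_id : ∀ a, eId V a ≫ map a a = eId V (o a)
  map_comp : ∀ a b c, eComp V a b c ≫ map a c =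
    (map a b ⊗ₘ map b c) ≫ eComp V (o a) (o b) (o c)

/-- The underlying `V`-functor. -/
abbrev FunctorOn.functor {A X : Type*} [EnrichedCategory V A] [EnrichedCategory V X] {o : A → X}
    (F : FunctorOn V o) : EnrichedFunctor V A X where
  obj := o
  map := F.map
  map_id := F.map_id
  map_comp := F.map_comp

/-- An equality of object maps is eliminated once here, so that later equations between action
morphisms need no transports. -/
lemma FunctorOn.exists_functor_eq {A X : Type*} [EnrichedCategory V A] [EnrichedCategory V X]
    (F : EnrichedFunctor V A X) {o : A → X} (h : F.obj = o) :
    ∃ G : FunctorOn V o, G.functor = F := by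
  subst h
  exact ⟨⟨F.map, F.map_id, F.map_comp⟩, rfl⟩

variable {A B' C : Type w} [EnrichedCategory V A] [EnrichedCategory V (A ⊕ B')]
  [EnrichedCategory V C]

/-- A `V`-functor to a `V`-category with objects `A ⊕ B'` which is `Sum.inl` on objects. -/
abbrev InlFunctor (V : Type v) [Category.{w} V] [MonoidalCategory V] (A B' : Type w)
    [EnrichedCategory V A] [EnrichedCategory V (A ⊕ B')] :=
  FunctorOn V (Sum.inl : A → A ⊕ B')

/-- The map from the objects of `A ⊕ B'` to the objects of the pushout. -/
abbrev glue (f : EnrichedFunctor V A C) : A ⊕ B' → C ⊕ B'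
  | Sum.inl a => Sum.inl (f.obj a)
  | Sum.inr b => Sum.inr b

/-! ### Glued modules and their homomorphisms -/

/-- A family of objects indexed by the objects of the pushout, with compatible module structures
over `C` and over the `V`-category with objects `A ⊕ B'`. -/
structure GluedModule (j : InlFunctor V A B') (f : EnrichedFunctor V A C) where
  obj : C ⊕ B' → V
  actC : Action C (fun c => obj (Sum.inl c))
  actB : Action (A ⊕ B') (fun y => obj (glue f y))
  compat : ∀ a a', (actB.restrict j.functor).act a a' = (actC.restrict f).act a a'

namespace GluedModule

variable {j : InlFunctor V A B'} {f : EnrichedFunctor V A C}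

/-- Homomorphisms of glued modules. -/
structure IsHom (Q R : GluedModule j f) (φ : ∀ x, Q.obj x ⟶ R.obj x) : Prop where
  linearC : Q.actC.Linear R.actC (fun c => φ (Sum.inl c))
  linearB : Q.actB.Linear R.actB (fun y => φ (glue f y))

/-- Homomorphisms of glued modules out of `K ⊗ Q`. -/
structure IsKHom (K : V) (Q R : GluedModule j f) (φ : ∀ x, K ⊗ Q.obj x ⟶ R.obj x) : Prop where
  linearC : Q.actC.KLinear K R.actC (fun c => φ (Sum.inl c))
  linearB : Q.actB.KLinear K R.actB (fun y => φ (glue f y))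

section Closed

variable [MonoidalClosed V]

/-- The cotensor of a glued module with an object of `V`. -/
@[simps]
def ihom (K : V) (R : GluedModule j f) : GluedModule j f where
  obj x := (CategoryTheory.ihom K).obj (R.obj x)
  actC := R.actC.ihom K
  actB := R.actB.ihom K
  compat a a' := (Action.restrict_ihom_act K R.actB j.functor a a').trans
    ((congrArg (fun t => MonoidalClosed.curry ((α_ K _ _).inv ≫ Action.eval K _ ▷ _ ≫ t))
      (R.compat a a')).trans (Action.restrict_ihom_act K R.actC f a a').symm)

lemma isHom_curry_iff {K : V} {Q R : GluedModule j f} {φ : ∀ x, K ⊗ Q.obj x ⟶ R.obj x} :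
    Q.IsHom (R.ihom K) (fun x => MonoidalClosed.curry (φ x)) ↔ Q.IsKHom K R φ :=
  ⟨fun h => ⟨Action.linear_curry_iff.1 h.1, Action.linear_curry_iff.1 h.2⟩,
    fun h => ⟨Action.linear_curry_iff.2 h.1, Action.linear_curry_iff.2 h.2⟩⟩

end Closed

/-- A glued module representing evaluation at `x`. -/
structure Representation (j : InlFunctor V A B') (f : EnrichedFunctor V A C) (x : C ⊕ B') where
  Q : GluedModule j f
  elt : 𝟙_ V ⟶ Q.obj x
  exists_hom : ∀ (R : GluedModule j f) (e : 𝟙_ V ⟶ R.obj x), ∃ φ, Q.IsHom R φ ∧ elt ≫ φ x = e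
  hom_ext : ∀ {R : GluedModule j f} {φ ψ : ∀ y, Q.obj y ⟶ R.obj y}, Q.IsHom R φ → Q.IsHom R ψ →
    elt ≫ φ x = elt ≫ ψ x → ∀ y, φ y = ψ y

section OfIso

variable {M : C → V} (μ : Action C M) {T : A ⊕ B' → V} (τ : Action (A ⊕ B') T)
  (e : ∀ a, T (Sum.inl a) ≅ M (f.obj a))
  (he : (τ.restrict j.functor).Linear (μ.restrict f) (fun a => (e a).hom))

/-- The comparison between the `A ⊕ B'`-module and the glued family. -/
def glueIso (y : A ⊕ B') : T y ≅ Sum.elim M (fun b => T (Sum.inr b)) (glue f y) :=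
  match y with
  | Sum.inl a => e a
  | Sum.inr b => Iso.refl (T (Sum.inr b))

/-- Glueing of a `C`-module and an `A ⊕ B'`-module with isomorphic restrictions to `A`. -/
@[simps obj actC actB]
def ofIso : GluedModule j f where
  obj := Sum.elim M (fun b => T (Sum.inr b))
  actC := μ
  actB := τ.transport (glueIso e)
  compat a a' := by
    have h : M (f.obj a) ◁ j.map a a' ≫ (e a).inv ▷ _ ≫ τ.act (Sum.inl a) (Sum.inl a') ≫
        (e a').hom = (μ.restrict f).act a a' := by
      have h' : (e a).hom ▷ _ ≫ (μ.restrict f).act a a' =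
        T (Sum.inl a) ◁ j.map a a' ≫ τ.act (Sum.inl a) (Sum.inl a') ≫ (e a').hom :=
          (he a a').trans (Category.assoc _ _ _)
      rw [whisker_exchange_assoc, ← h', inv_hom_whiskerRight_assoc]
    exact h

variable {μ τ e he}

lemma IsHom.linear_glueIso_comp {R : GluedModule j f} {φ : ∀ x, (ofIso μ τ e he).obj x ⟶ R.obj x}
    (hφ : (ofIso μ τ e he).IsHom R φ) :
    τ.Linear R.actB (fun y => (glueIso e y).hom ≫ φ (glue f y)) :=
  (Action.linear_transport (α := τ) (glueIso e)).comp hφ.linearB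

lemma exists_isHom_ofIso (R : GluedModule j f) {φ : ∀ c, M c ⟶ R.obj (Sum.inl c)}
    (hφ : μ.Linear R.actC φ) {ψ : ∀ y, T y ⟶ R.obj (glue f y)} (hψ : τ.Linear R.actB ψ)
    (h : ∀ a, ψ (Sum.inl a) = (e a).hom ≫ φ (f.obj a)) :
    ∃ χ, (ofIso μ τ e he).IsHom R χ ∧ (∀ c, χ (Sum.inl c) = φ c) ∧
      ∀ b, χ (Sum.inr b) = ψ (Sum.inr b) := by
  refine ⟨fun x => match x with
    | Sum.inl c => φ c
    | Sum.inr b => ψ (Sum.inr b), ⟨hφ, ?_⟩, fun _ => rfl, fun _ => rfl⟩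
  have h' := (Action.linear_transport (α := τ) (glueIso e)).inv.comp hψ
  -- The glued map, read over `A ⊕ B'`, is `ψ` transported along the comparison: on `A` this is the
  -- hypothesis `h`, on `B'` the comparison is an identity.
  have h'' : (fun y => (glueIso e y).inv ≫ ψ y) = fun y : A ⊕ B' =>
      match glue f y with
      | Sum.inl c => φ c
      | Sum.inr b => ψ (Sum.inr b) := by
    funext y
    match y with
    | Sum.inl a => exact (Iso.inv_comp_eq _).2 (h a)
    | Sum.inr b => exact Category.id_comp _
  exact h'' ▸ h'

end OfIso

/-! ### Representability of evaluation at the objects of the pushout -/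

section Representations

/-- Agreement of the two actions on `A` turns a `C`-homomorphism into data that extends along `j` to
a `B`-homomorphism. -/
lemma restrict_linearC (R : GluedModule j f) {M : C → V} {μ : Action C M}
    {φ : ∀ c, M c ⟶ R.obj (Sum.inl c)} (hφ : μ.Linear R.actC φ) :
    (μ.restrict f).Linear (R.actB.restrict j.functor) (fun a => φ (f.obj a)) := fun a a' =>
  (congrArg (φ (f.obj a) ▷ _ ≫ ·) (R.compat a a')).trans (hφ.restrict f a a')

lemma restrict_linearB (R : GluedModule j f) {N : A ⊕ B' → V} {ν : Action (A ⊕ B') N}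
    {φ : ∀ y, N y ⟶ R.obj (glue f y)} (hφ : ν.Linear R.actB φ) :
    (ν.restrict j.functor).Linear (R.actC.restrict f) (fun a => φ (Sum.inl a)) := fun a a' =>
  (congrArg (φ (Sum.inl a) ▷ _ ≫ ·) (R.compat a a')).symm.trans (hφ.restrict j.functor a a')

variable [HasInitial V] [HasColimitsOfSize.{w, w} V] [∀ X : V, (tensorRight X).IsLeftAdjoint]

variable (j f)

/-- The left Kan extension of the `C`-module represented by `c`. -/
abbrev kanC (c : C) : ModuleSpan j.functor :=
  kanSpan j.functor ((Action.representable (V := V) c).restrict f)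

variable (hj : j.functor.FullAndFaithful)

/-- The glued module represented by an object of `C`. -/
def moduleC (c : C) : GluedModule j f :=
  haveI := (kanC j f c).isIso_unit hj
  ofIso (Action.representable c) (kanC j f c).extAction
    (fun a => (asIso ((kanC j f c).unit a)).symm)
    (Action.Linear.inv (e := fun a => asIso ((kanC j f c).unit a)) (kanC j f c).unit_linear)

/-- Evaluation at an object of `C` is representable. -/
def representationC (c : C) : Representation j f (Sum.inl c) where
  Q := moduleC j f hj c
  elt := eId V c
  exists_hom R e := by
    have := (kanC j f c).isIso_unit hj
    have hφ := R.actC.yonedaHom_linear e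
    -- Yoneda fixes the part over `C`; its restriction to `A` then determines the part over `B` by
    -- the Kan extension property.
    obtain ⟨ψ, hψ, hψ'⟩ := kanSpan_exists_linear_desc R.actB (R.restrict_linearC hφ)
    obtain ⟨χ, hχ, hχC, -⟩ := exists_isHom_ofIso R hφ hψ (e := fun a =>
      (asIso ((kanC j f c).unit a)).symm)
      (he := Action.Linear.inv (e := fun a => asIso ((kanC j f c).unit a))
        (kanC j f c).unit_linear) (fun a => (Iso.eq_inv_comp _).2 (hψ' a))
    refine ⟨χ, hχ, ?_⟩
    rw [hχC]
    exact R.actC.eId_yonedaHom e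
  hom_ext {R φ ψ} hφ hψ h := by
    have := (kanC j f c).isIso_unit hj
    have hC (c' : C) : φ (Sum.inl c') = ψ (Sum.inl c') := by
      rw [hφ.linearC.eq_yonedaHom c', hψ.linearC.eq_yonedaHom c']
      exact congrArg (fun e => R.actC.yonedaHom e c') h
    have hB := kanSpan_linear_ext hφ.linear_glueIso_comp hψ.linear_glueIso_comp
      (fun a => congrArg (fun t => (kanC j f c).unit a ≫
        (asIso ((kanC j f c).unit a)).inv ≫ t) (hC (f.obj a)))
    rintro (c' | b)
    · exact hC c'
    · have := hB (Sum.inr b)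
      exact (Category.id_comp _).symm.trans (this.trans (Category.id_comp _))

/-- The left Kan extension of the restriction to `A` of the module represented by `b`. -/
abbrev kanA (b : B') : ModuleSpan f :=
  kanSpan f ((Action.representable (V := V) (Sum.inr b : A ⊕ B')).restrict j.functor)

/-- The span computing the part over `A ⊕ B'` of the glued module represented by `b`. -/
@[simps]
def spanB (b : B') : ModuleSpan j.functor where
  N y := ((Sum.inr b : A ⊕ B') ⟶[V] y)
  ν := Action.representable (Sum.inr b : A ⊕ B')
  P a := (kanA j f b).ext (f.obj a)
  π := (kanA j f b).extAction.restrict f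
  θ := (kanA j f b).unit
  linear := (kanA j f b).unit_linear

/-- The glued module represented by an object of `B'`. -/
def moduleB (b : B') : GluedModule j f :=
  haveI := (spanB j f b).isIso_unit hj
  ofIso (kanA j f b).extAction (spanB j f b).extAction
    (fun a => (asIso ((spanB j f b).unit a)).symm)
    (Action.Linear.inv (e := fun a => asIso ((spanB j f b).unit a)) (spanB j f b).unit_linear)

/-- Evaluation at an object of `B'` is representable. -/
def representationB (b : B') : Representation j f (Sum.inr b) where
  Q := moduleB j f hj b
  elt := eId V (Sum.inr b : A ⊕ B') ≫ (spanB j f b).inclN (Sum.inr b)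
  exists_hom R e := by
    have := (spanB j f b).isIso_unit hj
    have hN := R.actB.yonedaHom_linear (b := Sum.inr b) e
    obtain ⟨φ, hφ, hφ'⟩ := kanSpan_exists_linear_desc R.actC (R.restrict_linearB hN)
    obtain ⟨ψ, hψ, hψN, hψP⟩ := (spanB j f b).exists_linear_desc R.actB hN
      (R.restrict_linearC hφ) hφ'
    obtain ⟨χ, hχ, -, hχB⟩ := exists_isHom_ofIso R hφ hψ (e := fun a =>
      (asIso ((spanB j f b).unit a)).symm)
      (he := Action.Linear.inv (e := fun a => asIso ((spanB j f b).unit a))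
        (spanB j f b).unit_linear) (fun a => (Iso.eq_inv_comp _).2 (hψP a))
    refine ⟨χ, hχ, ?_⟩
    rw [hχB]
    refine (Category.assoc _ _ _).trans ((congrArg (eId V (Sum.inr b : A ⊕ B') ≫ ·) (hψN _)).trans ?_)
    exact R.actB.eId_yonedaHom (b := Sum.inr b) e
  hom_ext {R φ ψ} hφ hψ h := by
    have := (spanB j f b).isIso_unit hj
    let e (a : A) : (spanB j f b).ext (Sum.inl a) ≅ (kanA j f b).ext (f.obj a) :=
      (asIso ((spanB j f b).unit a)).symm
    -- On the copy of `B(b, -)` both maps are fixed by Yoneda from the value on the universal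
    -- element.
    have hN (y : A ⊕ B') : (spanB j f b).inclN y ≫ (glueIso e y).hom ≫ φ (glue f y) =
        (spanB j f b).inclN y ≫ (glueIso e y).hom ≫ ψ (glue f y) := by
      have h₁ := (spanB j f b).inclN_linear.comp hφ.linear_glueIso_comp
      have h₂ := (spanB j f b).inclN_linear.comp hψ.linear_glueIso_comp
      refine (h₁.eq_yonedaHom y).trans (Eq.trans ?_ (h₂.eq_yonedaHom y).symm)
      refine congrArg (fun e => R.actB.yonedaHom (b := Sum.inr b) e y) ?_
      have key {W X Y Z : V} (x : W ⟶ X) (n : X ⟶ Y) (χ : Y ⟶ Z) :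
          x ≫ n ≫ 𝟙 _ ≫ χ = (x ≫ n) ≫ χ := by simp
      exact (key _ _ _).trans (h.trans (key _ _ _).symm)
    -- By `θ_unit`, over `A` the copy of `B(b, -)` enters the `C`-part through the unit of the Kan
    -- extension along `f`. So `hN` gives agreement on that unit, hence on the whole `C`-part, and
    -- then on the `B`-part.
    have hu (a : A) (χ : (kanA j f b).ext (f.obj a) ⟶ R.obj (Sum.inl (f.obj a))) :
        (spanB j f b).inclN (Sum.inl a) ≫ (asIso ((spanB j f b).unit a)).inv ≫ χ =
          (kanA j f b).unit a ≫ χ := by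
      have key {W X Y Z : V} {t : W ⟶ X} {u : X ⟶ Y} {n : W ⟶ Y} (h : t ≫ u = n) [IsIso u]
          (χ : X ⟶ Z) : n ≫ (asIso u).inv ≫ χ = t ≫ χ := by simp [← h]
      exact key ((spanB j f b).θ_unit a) χ
    have hC := kanSpan_linear_ext hφ.linearC hψ.linearC (fun a =>
      (hu a _).symm.trans ((hN (Sum.inl a)).trans (hu a _)))
    have hB := (spanB j f b).linear_ext hφ.linear_glueIso_comp hψ.linear_glueIso_comp hN
      (fun a => congrArg (fun t => (spanB j f b).unit a ≫
        (asIso ((spanB j f b).unit a)).inv ≫ t) (hC (f.obj a)))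
    rintro (c | b')
    · exact hC c
    · exact (Category.id_comp _).symm.trans ((hB (Sum.inr b')).trans (Category.id_comp _))

end Representations

end GluedModule

end

/-! ### The `V`-category built from representations -/

section

variable {V : Type v} [Category.{w} V] [MonoidalCategory V]

namespace Action

variable {A : Type u₂} [EnrichedCategory V A] {B : Type u₁} [EnrichedCategory V B]
  {M N : B → V} {α : Action B M} {β : Action B N}

/-- When `φ` is composition, this says that composing with an arrow coming from `B` is the action of
`B`. -/
lemma KLinear.whiskerLeft_yonedaHom {b : B} {φ : ∀ y, N b ⊗ M y ⟶ N y}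
    (hφ : KLinear (N b) α β φ) {u : 𝟙_ V ⟶ M b} (hu : N b ◁ u ≫ φ b = (ρ_ _).hom) (y : B) :
    N b ◁ α.yonedaHom u y ≫ φ y = β.act b y := by
  have h := hφ b y
  rw [← Iso.inv_comp_eq] at h
  rw [yonedaHom, whiskerLeft_comp_assoc, whiskerLeft_comp_assoc, ← h,
    associator_inv_naturality_middle_assoc, ← comp_whiskerRight_assoc, hu]
  simp

lemma map_comp_yonedaHom (β : Action B N) (F : EnrichedFunctor V A B) (a a' : A)
    (e : 𝟙_ V ⟶ N (F.obj a)) :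
    F.map a a' ≫ β.yonedaHom e (F.obj a') =
      (λ_ _).inv ≫ e ▷ _ ≫ (β.restrict F).act a a' := by
  rw [yonedaHom, restrict_act, leftUnitor_inv_naturality_assoc, whisker_exchange_assoc]

lemma map_linear (F : EnrichedFunctor V A B) (a : A) :
    (representable a).Linear ((representable (F.obj a)).restrict F) (F.map a) := by
  intro x y
  simp [MonoidalCategory.tensorHom_def]

lemma yonedaHom_eId (F : EnrichedFunctor V A B) (a a' : A) :
    ((representable (F.obj a)).restrict F).yonedaHom (eId V (F.obj a)) a' = F.map a a' := by
  rw [(map_linear F a).eq_yonedaHom, F.map_id]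

lemma eComp_kLinear (b b' : B) :
    (representable b').KLinear (b ⟶[V] b') (representable b) (eComp V b b') := by
  intro x y
  simp [e_assoc']

lemma KLinear.restrict {K : V} {φ : ∀ x, K ⊗ M x ⟶ N x} (hφ : KLinear K α β φ)
    (F : EnrichedFunctor V A B) :
    KLinear K (α.restrict F) (β.restrict F) (fun a => φ (F.obj a)) := by
  intro x y
  simp only [restrict_act]
  rw [← whisker_exchange_assoc, hφ]
  simp

end Action

variable {A B' C : Type w} [EnrichedCategory V A] [EnrichedCategory V (A ⊕ B')]
  [EnrichedCategory V C] {j : InlFunctor V A B'} {f : EnrichedFunctor V A C}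

namespace GluedModule

namespace Representation

variable [MonoidalClosed V] {x : C ⊕ B'} (r : Representation j f x)

/-- The ordinary representing property is applied to the cotensor of `R` by `K`, then uncurried. -/
lemma exists_isKHom (K : V) (R : GluedModule j f) (k : K ⟶ R.obj x) :
    ∃ φ, r.Q.IsKHom K R φ ∧ K ◁ r.elt ≫ φ x = (ρ_ K).hom ≫ k := by
  obtain ⟨φ, hφ, hφ'⟩ := r.exists_hom (R.ihom K) (MonoidalClosed.curry ((ρ_ K).hom ≫ k))
  refine ⟨fun y => MonoidalClosed.uncurry (φ y), ⟨hφ.1.uncurry, hφ.2.uncurry⟩, ?_⟩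
  exact (MonoidalClosed.uncurry_natural_left _ _).symm.trans
    ((congrArg MonoidalClosed.uncurry hφ').trans (MonoidalClosed.uncurry_curry _))

variable {r} in
lemma isKHom_ext {K : V} {R : GluedModule j f} {φ ψ : ∀ y, K ⊗ r.Q.obj y ⟶ R.obj y}
    (hφ : r.Q.IsKHom K R φ) (hψ : r.Q.IsKHom K R ψ) (h : K ◁ r.elt ≫ φ x = K ◁ r.elt ≫ ψ x)
    (y : C ⊕ B') : φ y = ψ y := by
  refine MonoidalClosed.curry_injective
    (r.hom_ext (isHom_curry_iff.2 hφ) (isHom_curry_iff.2 hψ) ?_ y)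
  exact (MonoidalClosed.curry_natural_left _ _).symm.trans
    ((congrArg MonoidalClosed.curry h).trans (MonoidalClosed.curry_natural_left _ _))

end Representation

section

variable {Q R S : GluedModule j f}

lemma IsHom.id (Q : GluedModule j f) : Q.IsHom Q (fun _ => 𝟙 _) :=
  ⟨fun _ _ => by simp, fun _ _ => by simp⟩

lemma IsKHom.comp_isHom {K : V} {φ : ∀ x, K ⊗ Q.obj x ⟶ R.obj x} {ψ : ∀ x, R.obj x ⟶ S.obj x}
    (hφ : Q.IsKHom K R φ) (hψ : R.IsHom S ψ) : Q.IsKHom K S (fun x => φ x ≫ ψ x) :=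
  ⟨hφ.1.comp_linear hψ.1, hφ.2.comp_linear hψ.2⟩

lemma IsKHom.isHom_comp {K : V} {φ : ∀ x, Q.obj x ⟶ R.obj x} {ψ : ∀ x, K ⊗ R.obj x ⟶ S.obj x}
    (hφ : Q.IsHom R φ) (hψ : R.IsKHom K S ψ) : Q.IsKHom K S (fun x => K ◁ φ x ≫ ψ x) :=
  ⟨Action.KLinear.linear_comp hφ.1 hψ.1, Action.KLinear.linear_comp hφ.2 hψ.2⟩

lemma IsKHom.whiskerRight_comp {K L : V} (k : L ⟶ K) {φ : ∀ x, K ⊗ Q.obj x ⟶ R.obj x}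
    (hφ : Q.IsKHom K R φ) : Q.IsKHom L R (fun x => k ▷ Q.obj x ≫ φ x) :=
  ⟨hφ.1.whiskerRight_comp k, hφ.2.whiskerRight_comp k⟩

lemma IsKHom.comp {K L : V} {φ : ∀ x, L ⊗ Q.obj x ⟶ R.obj x} {ψ : ∀ x, K ⊗ R.obj x ⟶ S.obj x}
    (hφ : Q.IsKHom L R φ) (hψ : R.IsKHom K S ψ) :
    Q.IsKHom (K ⊗ L) S (fun x => (α_ K L (Q.obj x)).hom ≫ K ◁ φ x ≫ ψ x) :=
  ⟨hφ.1.comp hψ.1, hφ.2.comp hψ.2⟩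

lemma IsKHom.unitor_comp {K : V} {φ : ∀ x, K ⊗ Q.obj x ⟶ R.obj x} (hφ : Q.IsKHom K R φ)
    (k : 𝟙_ V ⟶ K) : Q.IsHom R (fun x => (λ_ (Q.obj x)).inv ≫ k ▷ Q.obj x ≫ φ x) :=
  ⟨hφ.1.unitor_comp k, hφ.2.unitor_comp k⟩

end

end GluedModule

open GluedModule

variable [MonoidalClosed V] (r : ∀ x, Representation j f x)

/-- Composition in the pushout. -/
def gluedComp (x y z : C ⊕ B') : (r x).Q.obj y ⊗ (r y).Q.obj z ⟶ (r x).Q.obj z :=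
  ((r y).exists_isKHom ((r x).Q.obj y) (r x).Q (𝟙 _)).choose z

lemma gluedComp_isKHom (x y : C ⊕ B') :
    (r y).Q.IsKHom ((r x).Q.obj y) (r x).Q (gluedComp r x y) :=
  ((r y).exists_isKHom ((r x).Q.obj y) (r x).Q (𝟙 _)).choose_spec.1

lemma whiskerLeft_elt_gluedComp (x y : C ⊕ B') :
    (r x).Q.obj y ◁ (r y).elt ≫ gluedComp r x y y = (ρ_ _).hom := by
  rw [← Category.comp_id (ρ_ _).hom]
  exact ((r y).exists_isKHom ((r x).Q.obj y) (r x).Q (𝟙 _)).choose_spec.2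

/-- The pushout as a `V`-category structure on `C ⊕ B'`. -/
abbrev gluedCategory : EnrichedCategory V (C ⊕ B') where
  Hom x y := (r x).Q.obj y
  id x := (r x).elt
  comp x y z := gluedComp r x y z
  id_comp x y := by
    -- Composition with the universal element on the left is an endomorphism of `Q x` fixing that
    -- element, hence the identity. The right unit law is the defining property of `gluedComp`.
    refine (r x).hom_ext ((gluedComp_isKHom r x x).unitor_comp (r x).elt) (IsHom.id _) ?_ y
    rw [leftUnitor_inv_naturality_assoc, whisker_exchange_assoc, whiskerLeft_elt_gluedComp,
      rightUnitor_naturality]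
    simp [unitors_inv_equal]
  comp_id x y := by
    rw [whiskerLeft_elt_gluedComp, Iso.inv_hom_id]
  assoc x y y' z := by
    rw [Iso.inv_comp_eq]
    -- Both bracketings are parametrised homomorphisms out of the module representing `y'`, so it
    -- suffices to compare them on its universal element.
    refine Representation.isKHom_ext
      ((gluedComp_isKHom r x y').whiskerRight_comp (gluedComp r x y y'))
      ((gluedComp_isKHom r y y').comp (gluedComp_isKHom r x y)) ?_ z
    rw [whisker_exchange_assoc, whiskerLeft_elt_gluedComp, associator_naturality_right_assoc,
      ← whiskerLeft_comp_assoc, whiskerLeft_elt_gluedComp]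
    simp

/-- The objects of the pushout. -/
@[nolint unusedArguments]
def Glued (_ : ∀ x, Representation j f x) : Type w := C ⊕ B'

instance : EnrichedCategory V (Glued r) := gluedCategory r

/-- The objects of the pushout, as a map out of `C ⊕ B'`. -/
abbrev Glued.of (x : C ⊕ B') : Glued r := x

lemma whiskerLeft_yonedaHomC_gluedComp (x : C ⊕ B') (c c' : C) :
    (r x).Q.obj (Sum.inl c) ◁ (r (Sum.inl c)).Q.actC.yonedaHom (r (Sum.inl c)).elt c' ≫
      gluedComp r x (Sum.inl c) (Sum.inl c') = (r x).Q.actC.act c c' :=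
  Action.KLinear.whiskerLeft_yonedaHom (b := c)
    (N := fun c => (r x).Q.obj (Sum.inl c)) (α := (r (Sum.inl c)).Q.actC) (β := (r x).Q.actC)
    (φ := fun c' => gluedComp r x (Sum.inl c) (Sum.inl c'))
    (gluedComp_isKHom r x (Sum.inl c)).linearC (whiskerLeft_elt_gluedComp r x (Sum.inl c)) c'

lemma whiskerLeft_yonedaHomB_gluedComp (x : C ⊕ B') (y z : A ⊕ B') :
    (r x).Q.obj (glue f y) ◁ (r (glue f y)).Q.actB.yonedaHom (r (glue f y)).elt z ≫
      gluedComp r x (glue f y) (glue f z) = (r x).Q.actB.act y z :=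
  Action.KLinear.whiskerLeft_yonedaHom (b := y)
    (N := fun y => (r x).Q.obj (glue f y)) (α := (r (glue f y)).Q.actB) (β := (r x).Q.actB)
    (φ := fun z => gluedComp r x (glue f y) (glue f z))
    (gluedComp_isKHom r x (glue f y)).linearB (whiskerLeft_elt_gluedComp r x (glue f y)) z

/-- The inclusion of `C` in the pushout. -/
def gluedInlC : FunctorOn V (fun c : C => Glued.of r (Sum.inl c)) where
  map c c' := (r (Sum.inl c)).Q.actC.yonedaHom (r (Sum.inl c)).elt c'
  map_id c := (r (Sum.inl c)).Q.actC.eId_yonedaHom (r (Sum.inl c)).elt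
  map_comp c c' c'' := by
    have h := ((r (Sum.inl c)).Q.actC.yonedaHom_linear (r (Sum.inl c)).elt c' c'').symm
    rw [← whiskerLeft_yonedaHomC_gluedComp, ← MonoidalCategory.tensorHom_def_assoc] at h
    exact h

/-- The map from `A ⊕ B'` to the pushout. -/
def gluedMapB : FunctorOn V (fun y : A ⊕ B' => Glued.of r (glue f y)) where
  map y z := (r (glue f y)).Q.actB.yonedaHom (r (glue f y)).elt z
  map_id y := (r (glue f y)).Q.actB.eId_yonedaHom (r (glue f y)).elt
  map_comp x y z := by
    have h := ((r (glue f x)).Q.actB.yonedaHom_linear (r (glue f x)).elt y z).symm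
    rw [← whiskerLeft_yonedaHomB_gluedComp, ← MonoidalCategory.tensorHom_def_assoc] at h
    exact h

/-- Both composites act on the universal element of `f a` by an arrow of `A`, once through `B` and
once through `C`; `compat` identifies the two actions. -/
lemma glued_comm : j.functor.comp V (gluedMapB r).functor = f.comp V (gluedInlC r).functor := by
  have h (a a' : A) : j.map a a' ≫ (gluedMapB r).map (Sum.inl a) (Sum.inl a') =
      f.map a a' ≫ (gluedInlC r).map (f.obj a) (f.obj a') := by
    let u := (r (Sum.inl (f.obj a))).elt
    exact (Action.map_comp_yonedaHom (r (Sum.inl (f.obj a))).Q.actB j.functor a a' u).trans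
      ((congrArg (fun t => (λ_ _).inv ≫ u ▷ _ ≫ t)
        ((r (Sum.inl (f.obj a))).Q.compat a a')).trans
          (Action.map_comp_yonedaHom (r (Sum.inl (f.obj a))).Q.actC f a a' u).symm)
  refine EnrichedFunctor.ext V (fun a => rfl) (fun a a' => ?_)
  exact (Category.comp_id _).trans (h a a')

/-! ### The universal property -/

section Desc

variable {X : Type w} [EnrichedCategory V X] {h : C ⊕ B' → X}
  (κ : FunctorOn V (fun c => h (Sum.inl c))) (β : FunctorOn V (fun y => h (glue f y)))

/-- The glued module represented by an object of the target of a cocone. -/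
abbrev coconeModule
    (comm : ∀ a a', j.map a a' ≫ β.map (Sum.inl a) (Sum.inl a') =
      f.map a a' ≫ κ.map (f.obj a) (f.obj a')) (x : X) : GluedModule j f where
  obj y := (x ⟶[V] h y)
  actC := (Action.representable x).restrict κ.functor
  actB := (Action.representable x).restrict β.functor
  compat a a' := by
    have H : (x ⟶[V] h (Sum.inl (f.obj a))) ◁ j.map a a' ≫
        (x ⟶[V] h (Sum.inl (f.obj a))) ◁ β.map (Sum.inl a) (Sum.inl a') ≫
        eComp V x (h (Sum.inl (f.obj a))) (h (Sum.inl (f.obj a'))) =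
        (x ⟶[V] h (Sum.inl (f.obj a))) ◁ f.map a a' ≫
        (x ⟶[V] h (Sum.inl (f.obj a))) ◁ κ.map (f.obj a) (f.obj a') ≫
        eComp V x (h (Sum.inl (f.obj a))) (h (Sum.inl (f.obj a'))) := by
      rw [← whiskerLeft_comp_assoc, comm, whiskerLeft_comp_assoc]
    exact H

variable (comm : ∀ a a', j.map a a' ≫ β.map (Sum.inl a) (Sum.inl a') =
      f.map a a' ≫ κ.map (f.obj a) (f.obj a'))

omit [MonoidalClosed V] in
lemma eComp_isKHom (x y : C ⊕ B') :
    (coconeModule κ β comm (h y)).IsKHom (h x ⟶[V] h y) (coconeModule κ β comm (h x))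
      (fun z => eComp V (h x) (h y) (h z)) :=
  ⟨(Action.eComp_kLinear (h x) (h y)).restrict κ.functor,
    (Action.eComp_kLinear (h x) (h y)).restrict β.functor⟩

/-- The `V`-functor out of the pushout induced by a cocone. -/
lemma exists_gluedDesc : ∃ d : FunctorOn V (fun x : Glued r => h x),
    ∀ x, (r x).Q.IsHom (coconeModule κ β comm (h x)) (d.map x) := by
  choose d hd hdu using fun x : C ⊕ B' =>
    (r x).exists_hom (coconeModule κ β comm (h x)) (eId V (h x))
  have hcomp (x y z : C ⊕ B') : gluedComp r x y z ≫ d x z =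
      d x y ▷ _ ≫ (h x ⟶[V] h y) ◁ d y z ≫ eComp V (h x) (h y) (h z) := by
    -- Functoriality is again tested on the universal element of `y`, which `d y` sends to the
    -- identity of `h y`.
    refine Representation.isKHom_ext ((gluedComp_isKHom r x y).comp_isHom (hd x))
      ((IsKHom.isHom_comp (hd y) (eComp_isKHom κ β comm x y)).whiskerRight_comp (d x y)) ?_ z
    have hρ := (Action.representable (V := V) (h x)).act_id (h y)
    simp only [Action.representable_act] at hρ
    rw [← Category.assoc, whiskerLeft_elt_gluedComp, whisker_exchange_assoc,
      ← whiskerLeft_comp_assoc, hdu, hρ, rightUnitor_naturality]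
  refine ⟨⟨d, hdu, fun x y z => (hcomp x y z).trans ?_⟩, hd⟩
  rw [← MonoidalCategory.tensorHom_def_assoc]

/-- The source of uniqueness: preservation of composition, applied to arrows from `C` and from `B`,
makes the functor a homomorphism of glued modules, and such maps are determined by the universal
element. -/
lemma isHom_of_functorOn (d : FunctorOn V (fun x : Glued r => h x))
    (hC : ∀ c c', (gluedInlC r).map c c' ≫ d.map (Sum.inl c) (Sum.inl c') = κ.map c c')
    (hB : ∀ y z, (gluedMapB r).map y z ≫ d.map (glue f y) (glue f z) = β.map y z) (x : C ⊕ B') :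
    (r x).Q.IsHom (coconeModule κ β comm (h x)) (d.map x) := by
  let D (x y : C ⊕ B') : (r x).Q.obj y ⟶ (h x ⟶[V] h y) := d.map x y
  have hd (y z : C ⊕ B') : gluedComp r x y z ≫ D x z =
      D x y ▷ _ ≫ (h x ⟶[V] h y) ◁ D y z ≫ eComp V (h x) (h y) (h z) := by
    rw [← MonoidalCategory.tensorHom_def_assoc]
    exact d.map_comp x y z
  have key (y z : C ⊕ B') {H : V} (m : H ⟶ (r y).Q.obj z)
      {a : (r x).Q.obj y ⊗ H ⟶ (r x).Q.obj z} (ha : (r x).Q.obj y ◁ m ≫ gluedComp r x y z = a)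
      {k : H ⟶ (h y ⟶[V] h z)} (hk : m ≫ D y z = k) :
      D x y ▷ H ≫ (h x ⟶[V] h y) ◁ k ≫ eComp V (h x) (h y) (h z) = a ≫ D x z := by
    rw [← ha, Category.assoc, hd, whisker_exchange_assoc, ← whiskerLeft_comp_assoc, hk]
  exact ⟨fun c c' => key _ _ _ (whiskerLeft_yonedaHomC_gluedComp r x c c') (hC c c'),
    fun y z => key _ _ _ (whiskerLeft_yonedaHomB_gluedComp r x y z) (hB y z)⟩

lemma elt_comp_functorOn (d : FunctorOn V (fun x : Glued r => h x)) (x : C ⊕ B') :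
    (r x).elt ≫ d.map x x = eId V (h x) :=
  d.map_id x

variable {r κ β comm} in
lemma gluedInlC_comp_desc {d : FunctorOn V (fun x : Glued r => h x)}
    (hd : ∀ x, (r x).Q.IsHom (coconeModule κ β comm (h x)) (d.map x)) (c c' : C) :
    (gluedInlC r).map c c' ≫ d.map (Sum.inl c) (Sum.inl c') = κ.map c c' :=
  ((hd (Sum.inl c)).linearC.yonedaHom_comp (b := c) (r (Sum.inl c)).elt c').trans
    ((congrArg (fun e => ((Action.representable (h (Sum.inl c))).restrict κ.functor).yonedaHom
      (b := c) e c') (elt_comp_functorOn r d (Sum.inl c))).trans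
        (Action.yonedaHom_eId κ.functor c c'))

variable {r κ β comm} in
lemma gluedMapB_comp_desc {d : FunctorOn V (fun x : Glued r => h x)}
    (hd : ∀ x, (r x).Q.IsHom (coconeModule κ β comm (h x)) (d.map x)) (y z : A ⊕ B') :
    (gluedMapB r).map y z ≫ d.map (glue f y) (glue f z) = β.map y z :=
  ((hd (glue f y)).linearB.yonedaHom_comp (b := y) (r (glue f y)).elt z).trans
    ((congrArg (fun e => ((Action.representable (h (glue f y))).restrict β.functor).yonedaHom
      (b := y) e z) (elt_comp_functorOn r d (glue f y))).trans
        (Action.yonedaHom_eId β.functor y z))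

end Desc

variable {X : Type w} [EnrichedCategory V X]

omit [MonoidalClosed V] in
lemma comp_assoc {A₁ A₂ A₃ A₄ : Type*} [EnrichedCategory V A₁] [EnrichedCategory V A₂]
    [EnrichedCategory V A₃] [EnrichedCategory V A₄] (F : EnrichedFunctor V A₁ A₂)
    (G : EnrichedFunctor V A₂ A₃) (H : EnrichedFunctor V A₃ A₄) :
    (F.comp V G).comp V H = F.comp V (G.comp V H) := by
  simp [EnrichedFunctor.comp]

/-- The universal property of the pushout. -/
theorem exists_desc (κ : EnrichedFunctor V C X) (β : EnrichedFunctor V (A ⊕ B') X)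
    (comm : j.functor.comp V β = f.comp V κ) :
    ∃ d : EnrichedFunctor V (Glued r) X,
      (gluedInlC r).functor.comp V d = κ ∧ (gluedMapB r).functor.comp V d = β := by
  obtain ⟨h, hκ, hβ⟩ : ∃ h : C ⊕ B' → X,
      (κ.obj = fun c => h (Sum.inl c)) ∧ β.obj = fun y => h (glue f y) := by
    -- The objects form a pushout of sets; commutativity is needed only over `A`.
    refine ⟨Sum.elim κ.obj (fun b => β.obj (Sum.inr b)), rfl, ?_⟩
    funext y
    match y with
    | Sum.inl a => exact congrArg (fun F => F.obj a) comm
    | Sum.inr b => rfl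
  obtain ⟨β, rfl⟩ := FunctorOn.exists_functor_eq β hβ
  obtain ⟨κ', hκ⟩ := FunctorOn.exists_functor_eq κ hκ
  rw [← hκ] at comm ⊢
  have comm' (a a' : A) : j.map a a' ≫ β.map (Sum.inl a) (Sum.inl a') =
      f.map a a' ≫ κ'.map (f.obj a) (f.obj a') := by
    injection comm with _ H
    exact congrFun (congrFun H a) a'
  obtain ⟨d, hd⟩ := exists_gluedDesc r κ' β comm'
  refine ⟨d.functor, ?_, ?_⟩
  · exact EnrichedFunctor.ext V (fun _ => rfl)
      (fun c c' => (Category.comp_id _).trans (gluedInlC_comp_desc hd c c'))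
  · exact EnrichedFunctor.ext V (fun _ => rfl)
      (fun y z => (Category.comp_id _).trans (gluedMapB_comp_desc hd y z))

theorem desc_ext (d d' : EnrichedFunctor V (Glued r) X)
    (hC : (gluedInlC r).functor.comp V d = (gluedInlC r).functor.comp V d')
    (hB : (gluedMapB r).functor.comp V d = (gluedMapB r).functor.comp V d') : d = d' := by
  obtain ⟨h, hh⟩ : ∃ h : C ⊕ B' → X, d.obj = fun x : Glued r => h x := ⟨d.obj, rfl⟩
  obtain ⟨d, rfl⟩ := FunctorOn.exists_functor_eq d hh
  have hd' : d'.obj = fun x : Glued r => h x := by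
    funext x
    match x with
    | Sum.inl c => exact (congrArg (fun F => F.obj c) hC).symm
    | Sum.inr b => exact (congrArg (fun F => F.obj (Sum.inr b)) hB).symm
  obtain ⟨d', rfl⟩ := FunctorOn.exists_functor_eq d' hd'
  obtain ⟨κ, hκ⟩ := FunctorOn.exists_functor_eq ((gluedInlC r).functor.comp V d.functor)
    (o := fun c => h (Sum.inl c)) rfl
  obtain ⟨β, hβ⟩ := FunctorOn.exists_functor_eq ((gluedMapB r).functor.comp V d.functor)
    (o := fun y => h (glue f y)) rfl
  have comm : j.functor.comp V β.functor = f.comp V κ.functor := by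
    rw [hκ, hβ]
    rw [← comp_assoc, glued_comm, comp_assoc]
  have comm' (a a' : A) : j.map a a' ≫ β.map (Sum.inl a) (Sum.inl a') =
      f.map a a' ≫ κ.map (f.obj a) (f.obj a') := by
    injection comm with _ H
    exact congrFun (congrFun H a) a'
  have key (e : FunctorOn V (fun x : Glued r => h x))
      (h₁ : (gluedInlC r).functor.comp V e.functor = κ.functor)
      (h₂ : (gluedMapB r).functor.comp V e.functor = β.functor) (x : C ⊕ B') :
      (r x).Q.IsHom (coconeModule κ β comm' (h x)) (e.map x) := by
    refine isHom_of_functorOn r κ β comm' e (fun c c' => ?_) (fun y z => ?_) x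
    · injection h₁ with _ H
      exact congrFun (congrFun H c) c'
    · injection h₂ with _ H
      exact congrFun (congrFun H y) z
  have hm (x y : C ⊕ B') : d.map x y = d'.map x y :=
    (r x).hom_ext (key d hκ.symm hβ.symm x) (key d' (hC.symm.trans hκ.symm)
      (hB.symm.trans hβ.symm) x)
      ((elt_comp_functorOn r d x).trans (elt_comp_functorOn r d' x).symm) y
  refine EnrichedFunctor.ext V (fun _ => rfl) (fun x y => ?_)
  exact (Category.comp_id _).trans (hm x y)

end

/-! ### Isomorphisms in `V-Cat` and reduction to the split form -/

section

variable {V : Type v} [Category.{w} V] [MonoidalCategory V]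

section Bijective

/-- Lifting of `V`-functors along a fully faithful `V`-functor. -/
lemma FunctorOn.exists_lift {S B Y : Type*} [EnrichedCategory V S] [EnrichedCategory V B]
    [EnrichedCategory V Y] {F : EnrichedFunctor V S B} (hF : F.FullAndFaithful)
    (H : EnrichedFunctor V Y B) {o : Y → S} (h : H.obj = fun y => F.obj (o y)) :
    ∃ G : FunctorOn V o, G.functor.comp V F = H := by
  obtain ⟨H, rfl⟩ := FunctorOn.exists_functor_eq H h
  unfold EnrichedFunctor.FullAndFaithful at hF
  refine ⟨⟨fun x y => H.map x y ≫ inv (F.map (o x) (o y)), fun x => ?_, fun x y z => ?_⟩, ?_⟩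
  · rw [← cancel_mono (F.map _ _)]
    simp [H.map_id]
  · rw [← cancel_mono (F.map _ _)]
    simp [H.map_comp]
  · refine EnrichedFunctor.ext V (fun _ => rfl) (fun x y => (Category.comp_id _).trans ?_)
    simp
    rfl

variable {A B : EnrichedCat.{w, v, w} V}

lemma fullAndFaithful_of_comp {A B C : EnrichedCat.{w, v, w} V} {F : A ⟶ B} {G : B ⟶ C}
    {H : A ⟶ C} (h : F ≫ G = H) (hG : EnrichedFunctor.FullAndFaithful G)
    (hH : EnrichedFunctor.FullAndFaithful H) : EnrichedFunctor.FullAndFaithful F := by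
  intro x y
  have h₁ : IsIso (EnrichedFunctor.map F x y ≫
      EnrichedFunctor.map G (EnrichedFunctor.obj F x) (EnrichedFunctor.obj F y)) := by
    subst h
    exact hH x y
  have h₂ := hG (EnrichedFunctor.obj F x) (EnrichedFunctor.obj F y)
  exact IsIso.of_isIso_comp_right _ (EnrichedFunctor.map G (EnrichedFunctor.obj F x)
    (EnrichedFunctor.obj F y))

lemma fullAndFaithful_id (A : EnrichedCat.{w, v, w} V) :
    EnrichedFunctor.FullAndFaithful (𝟙 A) := fun _ _ => inferInstanceAs (IsIso (𝟙 _))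

lemma exists_section {F : A ⟶ B} (hF : EnrichedFunctor.FullAndFaithful F)
    (hF' : Function.Bijective (EnrichedFunctor.obj F)) :
    ∃ G : B ⟶ A, G ≫ F = 𝟙 B ∧ EnrichedFunctor.FullAndFaithful G ∧
      Function.Bijective (EnrichedFunctor.obj G) := by
  let σ := Equiv.ofBijective _ hF'
  obtain ⟨G, hG⟩ := FunctorOn.exists_lift hF (EnrichedFunctor.id V B) (o := σ.symm)
    (funext fun b => (σ.apply_symm_apply b).symm)
  exact ⟨G.functor, hG, fullAndFaithful_of_comp (F := G.functor) hG hF (fullAndFaithful_id B),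
    σ.symm.bijective⟩

/-- A section is again fully faithful and bijective on objects, so it has a section too, which must
be `F`. -/
lemma isIso_of_bijective {F : A ⟶ B} (hF : EnrichedFunctor.FullAndFaithful F)
    (hF' : Function.Bijective (EnrichedFunctor.obj F)) : IsIso F := by
  obtain ⟨G, hG, hGf, hGb⟩ := exists_section hF hF'
  obtain ⟨G', hG', -, -⟩ := exists_section hGf hGb
  have : G' = F := by rw [← Category.id_comp F, ← hG', Category.assoc, hG, Category.comp_id]
  exact ⟨G, this ▸ hG', hG⟩

/-- A two-out-of-six argument: both round trips act by isomorphisms, so the action of the inverse is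
a split epimorphism and a monomorphism. -/
lemma fullAndFaithful_of_isIso (F : A ⟶ B) [IsIso F] : EnrichedFunctor.FullAndFaithful F := by
  intro x y
  have h {A B : EnrichedCat.{w, v, w} V} (F : A ⟶ B) (G : B ⟶ A) (h : F ≫ G = 𝟙 A) (x y : A) :
      IsIso (EnrichedFunctor.map F x y ≫
        EnrichedFunctor.map G (EnrichedFunctor.obj F x) (EnrichedFunctor.obj F y)) := by
    -- Transporting the property avoids comparing hom objects whose endpoints are only
    -- propositionally equal.
    have : EnrichedFunctor.FullAndFaithful (F ≫ G) := h ▸ fullAndFaithful_id A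
    exact this x y
  have h₁ := h F (inv F) (IsIso.hom_inv_id F) x y
  have h₂ := h (inv F) F (IsIso.inv_hom_id F) (EnrichedFunctor.obj F x) (EnrichedFunctor.obj F y)
  have : IsSplitEpi (EnrichedFunctor.map (inv F) (EnrichedFunctor.obj F x)
      (EnrichedFunctor.obj F y)) :=
    ⟨⟨⟨inv (EnrichedFunctor.map F x y ≫ EnrichedFunctor.map (inv F) (EnrichedFunctor.obj F x)
      (EnrichedFunctor.obj F y)) ≫ EnrichedFunctor.map F x y, by
        rw [Category.assoc, IsIso.inv_hom_id]⟩⟩⟩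
  have : Mono (EnrichedFunctor.map (inv F) (EnrichedFunctor.obj F x)
      (EnrichedFunctor.obj F y)) := mono_of_mono _ (EnrichedFunctor.map F _ _)
  have := isIso_of_mono_of_isSplitEpi (EnrichedFunctor.map (inv F) (EnrichedFunctor.obj F x)
      (EnrichedFunctor.obj F y))
  exact IsIso.of_isIso_comp_right _ (EnrichedFunctor.map (inv F) (EnrichedFunctor.obj F x)
      (EnrichedFunctor.obj F y))

lemma injective_obj_of_isIso (F : A ⟶ B) [IsIso F] :
    Function.Injective (EnrichedFunctor.obj F) :=
  Function.LeftInverse.injective (g := EnrichedFunctor.obj (inv F))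
    (fun x => congrArg (fun G : A ⟶ A => EnrichedFunctor.obj G x) (IsIso.hom_inv_id F))

lemma isFullAndFaithfulInclusion_comp_isIso {C : EnrichedCat.{w, v, w} V} {F : A ⟶ B}
    (hF : EnrichedFunctor.IsFullAndFaithfulInclusion F) (G : B ⟶ C) [IsIso G] :
    EnrichedFunctor.IsFullAndFaithfulInclusion (F ≫ G) where
  fullAndFaithful x y := by
    have h₁ := hF.fullAndFaithful x y
    have h₂ := fullAndFaithful_of_isIso G (EnrichedFunctor.obj F x) (EnrichedFunctor.obj F y)
    exact IsIso.comp_isIso' h₁ h₂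
  injective_obj := (injective_obj_of_isIso G).comp hF.injective_obj

end Bijective

/-- The `V`-category structure induced along a map to the objects of a `V`-category. -/
abbrev inducedCategory {S B : Type*} [EnrichedCategory V B] (o : S → B) :
    EnrichedCategory V S where
  Hom x y := (o x ⟶[V] o y)
  id x := eId V (o x)
  comp x y z := eComp V (o x) (o y) (o z)
  id_comp _ _ := e_id_comp V _ _
  comp_id _ _ := e_comp_id V _ _
  assoc _ _ _ _ := e_assoc V _ _ _ _

section

open GluedModule

variable [HasInitial V] [HasColimitsOfSize.{w, w} V] [∀ X : V, (tensorRight X).IsLeftAdjoint]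
  {A B' C : Type w} [EnrichedCategory V A] [EnrichedCategory V (A ⊕ B')]
  [EnrichedCategory V C]

/-- All evaluations at objects of the pushout are representable. -/
def representation {j : InlFunctor V A B'} (hj : j.functor.FullAndFaithful)
    (f : EnrichedFunctor V A C) : ∀ x, Representation j f x
  | Sum.inl c => representationC j f hj c
  | Sum.inr b => representationB j f hj b

variable [MonoidalClosed V]

/-- The `C`-part of the module representing `c` is `C(c, -)` with universal element the identity, so
the Yoneda map is the identity morphism. -/
lemma isFullAndFaithfulInclusion_gluedInlC {j : InlFunctor V A B'}
    (hj : j.functor.FullAndFaithful) (f : EnrichedFunctor V A C) :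
    (gluedInlC (representation hj f)).functor.IsFullAndFaithfulInclusion where
  fullAndFaithful c c' := by
    have : (Action.representable (V := V) c).yonedaHom (eId V c) c' = 𝟙 _ := e_id_comp V c c'
    have h : IsIso ((Action.representable (V := V) c).yonedaHom (eId V c) c') := by
      rw [this]
      infer_instance
    exact h
  injective_obj := Sum.inl_injective

omit [HasInitial V] [HasColimitsOfSize.{w, w} V] [∀ X : V, (tensorRight X).IsLeftAdjoint] in
lemma isPushout_glued {j : InlFunctor V A B'} {f : EnrichedFunctor V A C}
    (r : ∀ x, Representation j f x) :
    IsPushout (C := EnrichedCat.{w, v, w} V) (Z := EnrichedCat.of V A)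
      (X := EnrichedCat.of V (A ⊕ B')) (Y := EnrichedCat.of V C) (P := EnrichedCat.of V (Glued r))
      j.functor f (gluedMapB r).functor (gluedInlC r).functor := by
  refine ⟨⟨glued_comm r⟩, ⟨PushoutCocone.IsColimit.mk _
    (fun s => (exists_desc r (X := s.pt) s.inr s.inl s.condition).choose)
    (fun s => (exists_desc r (X := s.pt) s.inr s.inl s.condition).choose_spec.2)
    (fun s => (exists_desc r (X := s.pt) s.inr s.inl s.condition).choose_spec.1)
    (fun s m h₁ h₂ => desc_ext r (X := s.pt) _ _ ?_ ?_)⟩⟩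
  · exact h₂.trans (exists_desc r (X := s.pt) s.inr s.inl s.condition).choose_spec.1.symm
  · exact h₁.trans (exists_desc r (X := s.pt) s.inr s.inl s.condition).choose_spec.2.symm

end

theorem exists_isPushout [HasColimitsOfSize.{w, w} V] [MonoidalClosed V]
    [∀ X : V, (tensorRight X).IsLeftAdjoint] {A B C : EnrichedCat.{w, v, w} V} (i : A ⟶ B)
    (f : A ⟶ C) (hi : EnrichedFunctor.IsFullAndFaithfulInclusion i) :
    ∃ (D : EnrichedCat.{w, v, w} V) (g : B ⟶ D) (i' : C ⟶ D),
      IsPushout i f g i' ∧ EnrichedFunctor.IsFullAndFaithfulInclusion i' := by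
  -- Lowering the universe level supplies the initial object used for Kan extensions.
  have : HasColimitsOfSize.{0, 0} V := hasColimitsOfSizeShrink.{0, 0, w, w} V
  -- Injectivity on objects makes `o` a bijection, so `B` may be replaced by an isomorphic
  -- `V`-category in which `i` is `Sum.inl` on objects.
  let o : A ⊕ {b : B // b ∉ Set.range (EnrichedFunctor.obj i)} → B :=
    Sum.elim (EnrichedFunctor.obj i) Subtype.val
  let _ : EnrichedCategory V (A ⊕ {b : B // b ∉ Set.range (EnrichedFunctor.obj i)}) :=
    inducedCategory o
  let j : InlFunctor V A {b : B // b ∉ Set.range (EnrichedFunctor.obj i)} :=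
    ⟨EnrichedFunctor.map i, EnrichedFunctor.map_id i, EnrichedFunctor.map_comp i⟩
  have hj : j.functor.FullAndFaithful := hi.fullAndFaithful
  let e' : FunctorOn V o := ⟨fun _ _ => 𝟙 _, fun _ => Category.comp_id _, fun x y z => by
    rw [id_tensorHom_id, Category.id_comp]
    exact Category.comp_id _⟩
  let e : EnrichedCat.of V (A ⊕ {b : B // b ∉ Set.range (EnrichedFunctor.obj i)}) ⟶ B := e'.functor
  have he : IsIso e := isIso_of_bijective (fun _ _ => inferInstanceAs (IsIso (𝟙 _))) (by
    constructor
    · rintro (a | ⟨b, hb⟩) (a' | ⟨b', hb'⟩) h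
      · exact congrArg Sum.inl (hi.injective_obj h)
      · exact (hb' ⟨a, h⟩).elim
      · exact (hb ⟨a', h.symm⟩).elim
      · exact congrArg Sum.inr (Subtype.ext h)
    · intro b
      by_cases hb : b ∈ Set.range (EnrichedFunctor.obj i)
      · obtain ⟨a, rfl⟩ := hb
        exact ⟨Sum.inl a, rfl⟩
      · exact ⟨Sum.inr ⟨b, hb⟩, rfl⟩)
  have hje : (show A ⟶ EnrichedCat.of V
      (A ⊕ {b : B // b ∉ Set.range (EnrichedFunctor.obj i)}) from j.functor) ≫ e = i :=
    EnrichedFunctor.ext V (fun _ => rfl) (fun a a' =>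
      (Category.comp_id _).trans (Category.comp_id _))
  have hp := isPushout_glued (representation hj f)
  let g : EnrichedCat.of V (A ⊕ {b : B // b ∉ Set.range (EnrichedFunctor.obj i)}) ⟶
      EnrichedCat.of V (Glued (representation hj f)) := (gluedMapB (representation hj f)).functor
  let k : C ⟶ EnrichedCat.of V (Glued (representation hj f)) :=
    (gluedInlC (representation hj f)).functor
  refine ⟨EnrichedCat.of V (Glued (representation hj f)), inv e ≫ g, k, ?_, ?_⟩
  swap
  · exact isFullAndFaithfulInclusion_gluedInlC hj f
  refine IsPushout.of_iso hp (Iso.refl _) (asIso e) (Iso.refl _) (Iso.refl _) ?_ ?_ ?_ ?_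
  · exact hje.trans (Category.id_comp _).symm
  · exact (Category.comp_id _).trans (Category.id_comp _).symm
  · exact (Category.comp_id _).trans (IsIso.hom_inv_id_assoc e g).symm
  · exact (Category.comp_id k).trans (Category.id_comp k).symm

end

end EnrichedPushout

end

theorem proposition3p1
    {V : Type v} [Category.{w} V] [MonoidalCategory V] [HasColimitsOfSize.{w, w} V]
    [MonoidalClosed V] [∀ X : V, (tensorRight X).IsLeftAdjoint]
    {A B C : EnrichedCat.{w, v, w} V} (i : A ⟶ B) (f : A ⟶ C)
    (hi : EnrichedFunctor.IsFullAndFaithfulInclusion i) :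
    HasPushout i f ∧
      ∀ (D : EnrichedCat.{w, v, w} V) (g : B ⟶ D) (i' : C ⟶ D),
        IsPushout i f g i' → EnrichedFunctor.IsFullAndFaithfulInclusion i' := by
  obtain ⟨D₀, g₀, i₀, h₀, hi₀⟩ := EnrichedPushout.exists_isPushout i f hi
  refine ⟨h₀.hasPushout, fun D g i' h => ?_⟩
  -- Pushouts are unique up to isomorphism, and isomorphisms in `V-Cat` preserve full and faithful
  -- inclusions.
  rw [← h₀.inr_isoIsPushout_hom _ _ h]
  exact EnrichedPushout.isFullAndFaithfulInclusion_comp_isIso hi₀ _
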